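/- **Setting.** Let $\mathcal S,\mathcal A$ be measurable spaces, $\phi:\mathcal S\times\mathcal A\to\mathbb R^d$ a measurable feature map, $\rho$ a probability distribution on $\mathcal S$, $\mu(\cdot\mid s)$ a probability kernel from $\mathcal S$ to $\mathcal A\times\mathcal A$, and $\theta^*\in\mathbb R^d$. A sample $(s,a^0,a^1,y)$ is drawn by $s\sim\rho$, $(a^0,a^1)\sim\mu(\cdot\mid s)$ and, for $l\in\{0,1\}$, $$\mathbb P[y=l\mid s,a^0,a^1]=\frac{\exp(\phi(s,a^l)^\top\theta^*)}{\exp(\phi(s,a^0)^\top\theta^*)+\exp(\phi(s,a^1)^\top\theta^*)}.$$ Let $\mathcal D=(s_i,a_i^0,a_i^1,y_i)_{i=1}^n$, $n\ge 1$, be i.i.d. samples, put $x_i=\phi(s_i,a_i^1)-\phi(s_i,a_i^0)$, and let $w\sim\mathcal N(0,\sigma^2 I_d)$, $\sigma\ge 0$, be independent of $\mathcal D$. With the sigmoid function $\varsigma(z)=1/(1+e^{-z})$, $\beta>0$, and $\Theta_B=\{\theta\in\mathbb R^d:\langle \mathbf 1,\theta\rangle=0,\ \|\theta\|_2\le B\}$,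 let $$\hat\theta_{\rm obj}\in\arg\min_{\theta\in\Theta_B}\Big\{-\sum_{i=1}^n\big[\mathbf 1(y_i=1)\log\varsigma(x_i^\top\theta)+\mathbf 1(y_i=0)\log(1-\varsigma(x_i^\top\theta))\big]+\frac{\beta}{2}\|\theta\|_2^2+w^\top\theta\Big\}.$$ **Assumptions.** (Boundedness) $\theta^*\in\Theta_B$ and $\|\phi(s,a)\|_2\le L$ for all $(s,a)$. (Coverage) $\lambda_{\min}\big(\mathbb E[xx^\top]\big)\ge\kappa$ for some $\kappa>0$, where $x=\phi(s,a^1)-\phi(s,a^0)$, $s\sim\rho$, $(a^0,a^1)\sim\mu(\cdot\mid s)$. (Regularization) $\beta B\le K L\sqrt n$ for a constant $K>0$. **Theorem.** Let $\gamma=\dfrac{1}{2+\exp(-2LB)+\exp(2LB)}$. For every $K>0$ there is a constant $C>0$, depending on $K$ only, such that in the above setting and for every $\alpha\in(0,1)$, with probability at least $1-\alpha$, $$\|\hat\theta_{\rm obj}-\theta^*\|_2\le C\left(\frac{L}{\kappa\gamma}\sqrt{\frac{1+\log(1/\alpha)}{n}}+\frac{\sigma\big(\sqrt d+\sqrt{\log(1/\alpha)}\big)}{n\kappa\gamma}\right),$$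 and if $\alpha\le 1/2$, then also, with probability at least $1-\alpha$, $$\|\hat\theta_{\rm obj}-\theta^*\|_2\le C\left(\frac{L}{\kappa\gamma}\sqrt{\frac{\log(1/\alpha)}{n}}+\frac{\sigma\big(\sqrt d+\sqrt{\log(1/\alpha)}\big)}{n\kappa\gamma}\right).$$ If moreover $\epsilon\in(0,1]$, $\delta\in(0,1)$ and $\sigma=\dfrac{L\sqrt{8\log(2/\delta)+4\epsilon}}{\epsilon}$, then, with probability at least $1-\alpha$, $$\|\hat\theta_{\rm obj}-\theta^*\|_2\le C\sqrt{1+\log(1/\alpha)}\left(\frac{L}{\kappa\gamma\sqrt n}+\frac{L\sqrt{d\log(2/\delta)}}{n\epsilon\kappa\gamma}\right),$$ and if $\delta\le 1/2$, the same holds with $\log(1/\delta)$ in place of $\log(2/\delta)$. -/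

import Mathlib

open MeasureTheory ProbabilityTheory
open scoped ENNReal

namespace PrefReward

noncomputable section

/-- Euclidean space `ℝ^d`, with the `ℓ₂` norm. -/
abbrev Vec (d : ℕ) : Type := EuclideanSpace ℝ (Fin d)

/-- One preference sample `((s, (a⁰, a¹)), y)`; the label `y = 1` is `true`, `y = 0` is `false`. -/
abbrev Sample (S : Type*) (A : Type*) : Type _ := (S × (A × A)) × Bool

/-- The linear reward model `r_θ(s, a) = φ(s, a)ᵀ θ`. -/
def reward {S A : Type*} {d : ℕ} (φ : S → A → Vec d) (θ : Vec d) (s : S) (a : A) : ℝ :=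
  inner ℝ (φ s a) θ

/-- The differential feature `x = φ(s, a¹) - φ(s, a⁰)`. -/
def diffFeature {S A : Type*} {d : ℕ} (φ : S → A → Vec d) (p : S × (A × A)) : Vec d :=
  φ p.1 p.2.2 - φ p.1 p.2.1

/-- The Bradley-Terry-Luce probability that the label is `l`, given `(s, a⁰, a¹)`:
`exp (r_θ(s, aˡ)) / (exp (r_θ(s, a⁰)) + exp (r_θ(s, a¹)))`. -/
def btlProb {S A : Type*} {d : ℕ} (φ : S → A → Vec d) (θ : Vec d) (p : S × (A × A))
    (l : Bool) : ℝ :=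
  Real.exp (reward φ θ p.1 (if l then p.2.2 else p.2.1)) /
    (Real.exp (reward φ θ p.1 p.2.1) + Real.exp (reward φ θ p.1 p.2.2))

/-- The conditional law of the label given `(s, a⁰, a¹)`: it has mass `btlProb φ θ (s, a⁰, a¹) l`
at `l` (density with respect to counting measure on `Bool`). -/
def labelKernel {S A : Type*} [MeasurableSpace S] [MeasurableSpace A] {d : ℕ}
    (φ : S → A → Vec d) (θ : Vec d) : Kernel (S × (A × A)) Bool :=
  Kernel.withDensity (Kernel.const (S × (A × A)) (Measure.count : Measure Bool))
    (fun p l => ENNReal.ofReal (btlProb φ θ p l))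

/-- The law of one sample: `s ∼ ρ`, then `(a⁰, a¹) ∼ μ(· | s)`, then the label `y` from the
Bradley-Terry-Luce model with parameter `θ`. -/
def sampleLaw {S A : Type*} [MeasurableSpace S] [MeasurableSpace A] {d : ℕ}
    (ρ : Measure S) (μ : Kernel S (A × A)) (φ : S → A → Vec d) (θ : Vec d) :
    Measure (Sample S A) :=
  (ρ.compProd μ).compProd (labelKernel φ θ)

/-- The parameter set `Θ_B = {θ | ⟨1, θ⟩ = 0, ‖θ‖ ≤ B}`. -/
def paramSet (d : ℕ) (B : ℝ) : Set (Vec d) :=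
  {θ | ∑ i, θ i = 0 ∧ ‖θ‖ ≤ B}

/-- The population covariance matrix `Σ = E[x xᵀ]` of the differential features. -/
def popCov {S A : Type*} [MeasurableSpace S] [MeasurableSpace A] {d : ℕ}
    (ρ : Measure S) (μ : Kernel S (A × A)) (φ : S → A → Vec d) : Matrix (Fin d) (Fin d) ℝ :=
  Matrix.of fun i j => ∫ p, diffFeature φ p i * diffFeature φ p j ∂(ρ.compProd μ)

/-- `λ_min(M) ≥ κ` for a real symmetric matrix `M`: every real eigenvalue of `M` is at
least `κ`. -/
def MinEigenvalueGe {d : ℕ} (M : Matrix (Fin d) (Fin d) ℝ) (κ : ℝ) : Prop :=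
  ∀ l : ℝ, Module.End.HasEigenvalue (Matrix.toLin' M) l → κ ≤ l

/-- The negative log-likelihood `-∑ᵢ [1(yᵢ = 1) log σ(xᵢᵀθ) + 1(yᵢ = 0) log (1 - σ(xᵢᵀθ))]`,
where `σ` is the sigmoid function. -/
def negLogLik {S A : Type*} {d n : ℕ} (φ : S → A → Vec d) (D : Fin n → Sample S A)
    (θ : Vec d) : ℝ :=
  -∑ i, if (D i).2 then Real.log (Real.sigmoid (inner ℝ (diffFeature φ (D i).1) θ))
    else Real.log (1 - Real.sigmoid (inner ℝ (diffFeature φ (D i).1) θ))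

/-- The perturbed objective `l_D(θ) + (β / 2) ‖θ‖² + wᵀ θ`. -/
def objective {S A : Type*} {d n : ℕ} (φ : S → A → Vec d) (β : ℝ) (D : Fin n → Sample S A)
    (w : Vec d) (θ : Vec d) : ℝ :=
  negLogLik φ D θ + β / 2 * ‖θ‖ ^ 2 + inner ℝ w θ

/-- `θ` is the output of objective perturbation on the dataset `D` with noise `w`: it minimizes
the perturbed objective over `Θ_B`. -/
def IsObjEstimate {S A : Type*} {d n : ℕ} (φ : S → A → Vec d) (B β : ℝ)
    (D : Fin n → Sample S A) (w : Vec d) (θ : Vec d) : Prop :=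
  θ ∈ paramSet d B ∧ IsMinOn (objective φ β D w) (paramSet d B) θ

/-- The curvature constant `γ = 1 / (2 + exp (-2LB) + exp (2LB))`. -/
def gammaCoef (L B : ℝ) : ℝ := 1 / (2 + Real.exp (-2 * L * B) + Real.exp (2 * L * B))

/-- The noise level `L √(8 log (2/δ) + 4ε) / ε` of the private estimator. -/
def privacyNoise (L ε δ : ℝ) : ℝ := L * Real.sqrt (8 * Real.log (2 / δ) + 4 * ε) / ε

/-- The Gaussian law `N(0, τ² I)` on `ℝ^d`. -/
def gaussianNoise (d : ℕ) (τ : ℝ) : Measure (Vec d) :=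
  multivariateGaussian 0 ((τ ^ 2) • (1 : Matrix (Fin d) (Fin d) ℝ))

lemma btlProb_nonneg {S A : Type*} {d : ℕ} (φ : S → A → Vec d) (θ : Vec d)
    (p : S × (A × A)) (l : Bool) : 0 ≤ btlProb φ θ p l := by
  unfold btlProb; positivity

lemma btlProb_add {S A : Type*} {d : ℕ} (φ : S → A → Vec d) (θ : Vec d)
    (p : S × (A × A)) : btlProb φ θ p true + btlProb φ θ p false = 1 := by
  have h : Real.exp (reward φ θ p.1 p.2.1) + Real.exp (reward φ θ p.1 p.2.2) ≠ 0 := by positivity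
  simp only [btlProb, if_true, Bool.false_eq_true, if_false]
  field_simp
  ring

lemma measurable_btlProb {S A : Type*} [MeasurableSpace S] [MeasurableSpace A] {d : ℕ}
    {φ : S → A → Vec d} (hφ : Measurable (Function.uncurry φ)) (θ : Vec d) :
    Measurable (Function.uncurry (btlProb φ θ)) := by
  have h0 : Measurable fun p : S × (A × A) => reward φ θ p.1 p.2.1 :=
    (hφ.comp (measurable_fst.prodMk (measurable_fst.comp measurable_snd))).inner
      measurable_const
  have h1 : Measurable fun p : S × (A × A) => reward φ θ p.1 p.2.2 :=
    (hφ.comp (measurable_fst.prodMk (measurable_snd.comp measurable_snd))).inner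
      measurable_const
  refine measurable_from_prod_countable_left fun l => ?_
  cases l <;> simp only [Function.uncurry, btlProb, if_true, Bool.false_eq_true, if_false] <;>
    fun_prop

/-- The label kernel is a genuine conditional probability. -/
lemma isMarkovKernel_labelKernel {S A : Type*} [MeasurableSpace S] [MeasurableSpace A] {d : ℕ}
    {φ : S → A → Vec d} (hφ : Measurable (Function.uncurry φ)) (θ : Vec d) :
    IsMarkovKernel (labelKernel φ θ) := by
  refine ⟨fun p => ⟨?_⟩⟩
  have hm : Measurable (Function.uncurry fun p l => ENNReal.ofReal (btlProb φ θ p l)) :=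
    (measurable_btlProb hφ θ).ennreal_ofReal
  rw [labelKernel, Kernel.withDensity_apply _ hm, withDensity_apply _ MeasurableSet.univ]
  simp only [Kernel.const_apply, Measure.restrict_univ]
  rw [lintegral_count, tsum_fintype, Fintype.sum_bool,
    ← ENNReal.ofReal_add (btlProb_nonneg _ _ _ _) (btlProb_nonneg _ _ _ _), btlProb_add,
    ENNReal.ofReal_one]

/-- The constrained minimization problem always has a solution. -/
lemma exists_isObjEstimate {S A : Type*} {d n : ℕ} (φ : S → A → Vec d) {B : ℝ} (hB : 0 ≤ B)
    (β : ℝ) (D : Fin n → Sample S A) (w : Vec d) : ∃ θ, IsObjEstimate φ B β D w θ := by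
  have hc : IsCompact (paramSet d B) := by
    have h : paramSet d B = Metric.closedBall 0 B ∩ {θ : Vec d | ∑ i, θ i = 0} := by
      ext θ
      simp [paramSet, and_comm]
    rw [h]
    exact (isCompact_closedBall 0 B).inter_right (isClosed_eq (by fun_prop) continuous_const)
  have hσ : Continuous Real.sigmoid := by
    have h : ∀ x : ℝ, 1 + Real.exp (-x) ≠ 0 := fun x => by positivity
    unfold Real.sigmoid
    exact (by fun_prop : Continuous fun x : ℝ => 1 + Real.exp (-x)).inv₀ h
  have hs : Continuous fun x : ℝ => Real.log (Real.sigmoid x) :=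
    hσ.log fun x => (Real.sigmoid_pos x).ne'
  have hs' : Continuous fun x : ℝ => Real.log (1 - Real.sigmoid x) :=
    (continuous_const.sub hσ).log fun x =>
      (sub_pos.2 (Real.sigmoid_lt_one x)).ne'
  have hcont : Continuous (objective φ β D w) := by
    unfold objective negLogLik
    refine ((Continuous.neg (continuous_finsetSum _ fun i _ => ?_)).add (by fun_prop)).add
      (by fun_prop)
    cases (D i).2
    · simp only [Bool.false_eq_true, if_false]
      exact hs'.comp (f := fun θ : Vec d => inner ℝ (diffFeature φ (D i).1) θ) (by fun_prop)
    · simp only [if_true]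
      exact hs.comp (f := fun θ : Vec d => inner ℝ (diffFeature φ (D i).1) θ) (by fun_prop)
  obtain ⟨θ, hθ, hmin⟩ := hc.exists_isMinOn ⟨0, by simp [paramSet, hB]⟩ hcont.continuousOn
  exact ⟨θ, hθ, hmin⟩

end

end PrefReward

/-! On `Θ_B` each logit is at most `2LB` in absolute value, so the logistic loss has curvature at
least `γ` there. Comparing the objective at the minimizer with its value at `θ*`, and writing `Δ`
for the error, gives `(γ/2) ∑ ⟨xᵢ, Δ⟩² ≤ ‖Δ‖ (‖∑ scoreᵢ‖ + βB + ‖w‖)`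
(`IsObjEstimate.basic_inequality`). The scores at `θ*` are bounded, independent and centred, so
their sum has norm of order `L √(n (1 + log(1/α)))`, with no dependence on `d`. The tool is
`measure_norm_sum_gt_le`, a Hilbert-space Hoeffding bound obtained from the moment `E exp(c‖S‖²)`.
The regularization assumption puts `βB` at the same scale, and `‖w‖` is controlled by its own
exponential-square moment.

For the left side, `∑ xᵢ ⊗ xᵢ` is a sum of vectors in Frobenius norm, and the same inequality bounds
its deviation `N` from `n E[x ⊗ x]`, again free of dimension. If `N ≤ nκ/2`, the left side is at
least `γnκ‖Δ‖²/4` and one divides by `‖Δ‖`. Otherwise `n` is so small that the trivial bound `‖Δ‖ ≤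
2B`, with `2LBγ ≤ 1`, is already good enough (`error_le_of_bounds`). Hence no lower bound on the
sample size is needed. -/

namespace PrefReward

/-! ### Hoeffding-type concentration in Hilbert space. -/

section Concentration

variable {Ω E : Type*} [MeasurableSpace Ω] {P : Measure Ω} [IsProbabilityMeasure P]
  [NormedAddCommGroup E] [InnerProductSpace ℝ E] [CompleteSpace E] [MeasurableSpace E]
  [BorelSpace E] [SecondCountableTopology E]

omit [InnerProductSpace ℝ E] [CompleteSpace E] [SecondCountableTopology E] in
lemma integrable_exp_mul_sq_norm {X : Ω → E} (hX : AEMeasurable X P) {M : ℝ}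
    (hM : ∀ᵐ ω ∂P, ‖X ω‖ ≤ M) {c : ℝ} (hc : 0 ≤ c) :
    Integrable (fun ω => Real.exp (c * ‖X ω‖ ^ 2)) P := by
  refine Integrable.of_bound (C := Real.exp (c * M ^ 2))
    (((hX.norm.pow_const 2).const_mul c).exp.aestronglyMeasurable) ?_
  filter_upwards [hM] with ω h
  rw [Real.norm_of_nonneg (Real.exp_pos _).le]
  gcongr

/-- One step of the exponential-square moment recursion. -/
lemma integral_exp_sq_norm_add_le {ν : Measure E} [IsProbabilityMeasure ν] {M : ℝ}
    (hM : ∀ᵐ x ∂ν, ‖x‖ ≤ M) (h0 : ∫ x, x ∂ν = 0) {c : ℝ} (hc : 0 ≤ c) (s : E) :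
    ∫ x, Real.exp (c * ‖s + x‖ ^ 2) ∂ν ≤
      Real.exp (c * M ^ 2) * Real.exp (c * (1 + 2 * c * M ^ 2) * ‖s‖ ^ 2) := by
  have hint : Integrable (fun x : E => x) ν :=
    Integrable.of_bound (C := M) aestronglyMeasurable_id hM
  have hM0 : 0 ≤ M := by
    obtain ⟨x, hx⟩ := hM.exists
    exact (norm_nonneg x).trans hx
  have hmem : ∀ᵐ x ∂ν, inner ℝ s x ∈ Set.Icc (-(‖s‖ * M)) (‖s‖ * M) := by
    filter_upwards [hM] with x hx
    rw [Set.mem_Icc, ← abs_le]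
    exact (abs_real_inner_le_norm s x).trans (by gcongr)
  have hmeas : AEMeasurable (fun x : E => inner ℝ s x) ν := by fun_prop
  -- Expanding the square leaves only the cross term `2c⟨s, x⟩` to average; it is a bounded centred
  -- scalar, so Hoeffding's lemma applies.
  have hsub := hasSubgaussianMGF_of_mem_Icc_of_integral_eq_zero hmeas hmem
    (by rw [integral_inner hint, h0, inner_zero_right])
  have hmgf := hsub.mgf_le (2 * c)
  have hnn : (((‖‖s‖ * M - -(‖s‖ * M)‖₊ / 2) ^ 2 : NNReal) : ℝ) = (‖s‖ * M) ^ 2 := by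
    push_cast
    rw [Real.norm_of_nonneg (by nlinarith [mul_nonneg (norm_nonneg s) hM0])]
    ring
  rw [hnn] at hmgf
  calc ∫ x, Real.exp (c * ‖s + x‖ ^ 2) ∂ν
      ≤ ∫ x, Real.exp (c * ‖s‖ ^ 2 + c * M ^ 2) * Real.exp (2 * c * inner ℝ s x) ∂ν := by
        refine integral_mono_of_nonneg (Filter.Eventually.of_forall fun x => (Real.exp_pos _).le)
          ((hsub.integrable_exp_mul (2 * c)).const_mul _) ?_
        filter_upwards [hM] with x hx
        rw [← Real.exp_add, Real.exp_le_exp, norm_add_sq_real]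
        have : ‖x‖ ^ 2 ≤ M ^ 2 := by gcongr
        nlinarith
    _ = Real.exp (c * ‖s‖ ^ 2 + c * M ^ 2) * mgf (fun x => inner ℝ s x) ν (2 * c) := by
        rw [integral_const_mul]; rfl
    _ ≤ Real.exp (c * ‖s‖ ^ 2 + c * M ^ 2) * Real.exp ((‖s‖ * M) ^ 2 * (2 * c) ^ 2 / 2) := by
        gcongr
    _ = _ := by
        rw [← Real.exp_add, ← Real.exp_add]
        ring_nf

/-- Summands are integrated out one at a time. Each step replaces `c` by `c(1 + 2cM²)`, and the
choice `c = 1/(b + 2NM²)` makes this at most the value for `N - 1` with the same `b`; each step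
costs a factor of at most `exp(M²/b)`. -/
lemma integral_exp_sq_norm_sum_le {ι : Type*} {X : ι → Ω → E}
    (hX : ∀ i, AEMeasurable (X i) P) (hind : iIndepFun X P) {M : ℝ}
    (hM : ∀ i, ∀ᵐ ω ∂P, ‖X i ω‖ ≤ M) (h0 : ∀ i, ∫ ω, X i ω ∂P = 0) (s : Finset ι) :
    ∀ b : ℝ, 0 < b →
      ∫ ω, Real.exp (1 / (b + 2 * s.card * M ^ 2) * ‖∑ i ∈ s, X i ω‖ ^ 2) ∂P ≤
        Real.exp (s.card * M ^ 2 / b) := by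
  classical
  have hSm : ∀ s : Finset ι, AEMeasurable (fun ω => ∑ i ∈ s, X i ω) P := fun s =>
    Finset.aemeasurable_fun_sum s fun i _ => hX i
  have hSb : ∀ s : Finset ι, ∀ᵐ ω ∂P, ‖∑ i ∈ s, X i ω‖ ≤ s.card * M := fun s => by
    have : ∀ᵐ ω ∂P, ∀ i ∈ s, ‖X i ω‖ ≤ M := by
      rw [Finset.eventually_all]
      exact fun i _ => hM i
    filter_upwards [this] with ω h
    calc ‖∑ i ∈ s, X i ω‖ ≤ ∑ _i ∈ s, M := norm_sum_le_of_le _ h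
      _ = s.card * M := by simp
  induction s using Finset.induction_on with
  | empty => intro b hb; simp
  | insert a s ha ih =>
    intro b hb
    set N : ℝ := (s.card : ℝ) with hN
    have hN0 : 0 ≤ N := by positivity
    have hcard : ((insert a s).card : ℝ) = N + 1 := by
      rw [Finset.card_insert_of_notMem ha]; push_cast; rfl
    rw [hcard]
    set c : ℝ := 1 / (b + 2 * (N + 1) * M ^ 2) with hc
    have hcpos : 0 < c := by positivity
    have hindep : IndepFun (fun ω => ∑ i ∈ s, X i ω) (X a) P := by
      have := hind.indepFun_finsetSum_of_notMem₀ hX ha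
      convert this using 1
      ext ω; simp
    set ν := P.map (X a)
    set ξ := P.map (fun ω => ∑ i ∈ s, X i ω)
    have : IsProbabilityMeasure ν := Measure.isProbabilityMeasure_map (hX a)
    have : IsProbabilityMeasure ξ := Measure.isProbabilityMeasure_map (hSm s)
    have hpair : P.map (fun ω => (∑ i ∈ s, X i ω, X a ω)) = ξ.prod ν :=
      (indepFun_iff_map_prod_eq_prod_map_map (hSm s) (hX a)).1 hindep
    have hpm : AEMeasurable (fun ω => (∑ i ∈ s, X i ω, X a ω)) P := (hSm s).prodMk (hX a)
    have hFc : Continuous fun q : E × E => Real.exp (c * ‖q.1 + q.2‖ ^ 2) := by fun_prop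
    have hsum : ∀ ω, ∑ i ∈ insert a s, X i ω = (∑ i ∈ s, X i ω) + X a ω := fun ω => by
      rw [Finset.sum_insert ha, add_comm]
    have hi1 : Integrable (fun q : E × E => Real.exp (c * ‖q.1 + q.2‖ ^ 2)) (ξ.prod ν) := by
      rw [← hpair, integrable_map_measure hFc.aestronglyMeasurable hpm]
      have := integrable_exp_mul_sq_norm (hSm (insert a s)) (hSb (insert a s)) hcpos.le
      simp only [hsum] at this
      exact this
    have hνM : ∀ᵐ x ∂ν, ‖x‖ ≤ M :=
      (ae_map_iff (hX a) (measurableSet_le measurable_norm measurable_const)).2 (hM a)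
    have hν0 : ∫ x, x ∂ν = 0 := by
      rw [← h0 a]
      exact integral_map (hX a) aestronglyMeasurable_id
    set c' : ℝ := c * (1 + 2 * c * M ^ 2)
    have hc'0 : 0 ≤ c' := by positivity
    -- With `T = b + 2(N+1)M²` this is `(T + 2M²)(T - 2M²) ≤ T²`.
    have hc' : c' ≤ 1 / ((b) + 2 * N * M ^ 2) := by
      have e : c' = (b + 2 * (N + 1) * M ^ 2 + 2 * M ^ 2) / (b + 2 * (N + 1) * M ^ 2) ^ 2 := by
        simp only [c', hc]
        field_simp
      rw [e, div_le_div_iff₀ (by positivity) (by positivity)]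
      nlinarith [sq_nonneg (M ^ 2)]
    have hi2 := integrable_exp_mul_sq_norm (hSm s) (hSb s) hc'0
    have hi3 := integrable_exp_mul_sq_norm (hSm s) (hSb s)
      (show (0 : ℝ) ≤ 1 / (b + 2 * N * M ^ 2) by positivity)
    calc ∫ ω, Real.exp (c * ‖∑ i ∈ insert a s, X i ω‖ ^ 2) ∂P
        = ∫ q, Real.exp (c * ‖q.1 + q.2‖ ^ 2) ∂(ξ.prod ν) := by
          rw [← hpair, integral_map hpm hFc.aestronglyMeasurable]
          simp only [hsum]
      _ = ∫ v, ∫ x, Real.exp (c * ‖v + x‖ ^ 2) ∂ν ∂ξ := integral_prod _ hi1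
      _ ≤ ∫ v, Real.exp (c * M ^ 2) * Real.exp (c' * ‖v‖ ^ 2) ∂ξ := by
          refine integral_mono hi1.integral_prod_left ?_ fun v =>
            integral_exp_sq_norm_add_le hνM hν0 hcpos.le v
          refine Integrable.const_mul ?_ _
          rw [integrable_map_measure (by fun_prop) (hSm s)]
          exact hi2
      _ = Real.exp (c * M ^ 2) * ∫ ω, Real.exp (c' * ‖∑ i ∈ s, X i ω‖ ^ 2) ∂P := by
          rw [integral_const_mul, integral_map (hSm s) (by fun_prop)]
      _ ≤ Real.exp (c * M ^ 2) *
            ∫ ω, Real.exp (1 / (b + 2 * N * M ^ 2) * ‖∑ i ∈ s, X i ω‖ ^ 2) ∂P := by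
          gcongr ?_ * ?_
          refine integral_mono hi2 hi3 fun ω => ?_
          simp only
          gcongr
      _ ≤ Real.exp (M ^ 2 / b) * Real.exp (N * M ^ 2 / b) := by
          gcongr
          · rw [hc, one_div_mul_eq_div]
            gcongr
            nlinarith [mul_nonneg hN0 (sq_nonneg M), sq_nonneg M]
          · exact ih b hb
      _ = Real.exp ((N + 1) * M ^ 2 / b) := by
          rw [← Real.exp_add]
          ring_nf

/-- Markov's inequality for an exponential moment. -/
lemma measure_lt_le_of_integral_exp_le {Y : Ω → ℝ} {C : ℝ}
    (hi : Integrable (fun ω => Real.exp (Y ω)) P) (hC : ∫ ω, Real.exp (Y ω) ∂P ≤ Real.exp C)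
    {a : ℝ} (ha : 0 < a) :
    P {ω | C + Real.log (1 / a) < Y ω} ≤ ENNReal.ofReal a := by
  have hpos : 0 < Real.exp (C + Real.log (1 / a)) := Real.exp_pos _
  have hmk := mul_meas_ge_le_integral_of_nonneg
    (Filter.Eventually.of_forall fun ω => (Real.exp_pos (Y ω)).le) hi
    (Real.exp (C + Real.log (1 / a)))
  have h1 : P.real {ω | Real.exp (C + Real.log (1 / a)) ≤ Real.exp (Y ω)} ≤ a := by
    have h2 : Real.exp (C + Real.log (1 / a)) = Real.exp C / a := by
      rw [Real.exp_add, Real.exp_log (by positivity)]; ring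
    have h3 := hmk.trans hC
    rw [h2] at h3 ⊢
    have : 0 < Real.exp C := Real.exp_pos C
    rw [div_mul_eq_mul_div, div_le_iff₀ ha] at h3
    exact le_of_mul_le_mul_left h3 this
  calc P {ω | C + Real.log (1 / a) < Y ω}
      ≤ P {ω | Real.exp (C + Real.log (1 / a)) ≤ Real.exp (Y ω)} :=
        measure_mono fun ω (hω : _ < _) => Real.exp_le_exp.2 hω.le
    _ = ENNReal.ofReal (P.real {ω | Real.exp (C + Real.log (1 / a)) ≤ Real.exp (Y ω)}) := by
        rw [ofReal_measureReal]
    _ ≤ ENNReal.ofReal a := ENNReal.ofReal_le_ofReal h1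

/-- Dimension-free concentration for sums of bounded independent centred vectors. -/
lemma measure_norm_sum_gt_le {n : ℕ} (hn : 0 < n) {X : Fin n → Ω → E}
    (hX : ∀ i, AEMeasurable (X i) P) (hind : iIndepFun X P) {M : ℝ} (hMpos : 0 < M)
    (hM : ∀ i, ∀ᵐ ω ∂P, ‖X i ω‖ ≤ M) (h0 : ∀ i, ∫ ω, X i ω ∂P = 0) {a : ℝ} (ha : 0 < a) :
    P {ω | 4 * n * M ^ 2 * (1 / 2 + Real.log (1 / a)) < ‖∑ i, X i ω‖ ^ 2} ≤
      ENNReal.ofReal a := by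
  have hn' : (0 : ℝ) < n := by exact_mod_cast hn
  -- The choice `b = 2nM²` gives exponent `1/(4nM²)` and moment at most `exp(1/2)`.
  have key := integral_exp_sq_norm_sum_le hX hind hM h0 Finset.univ (2 * n * M ^ 2) (by positivity)
  have e1 : (2 * n * M ^ 2 + 2 * ((Finset.univ : Finset (Fin n)).card : ℝ) * M ^ 2) =
      4 * n * M ^ 2 := by simp; ring
  have e2 : ((Finset.univ : Finset (Fin n)).card : ℝ) * M ^ 2 / (2 * n * M ^ 2) = 1 / 2 := by
    simp; field_simp
  rw [e1, e2] at key
  have hSb : ∀ᵐ ω ∂P, ‖∑ i, X i ω‖ ≤ n * M := by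
    filter_upwards [ae_all_iff.2 hM] with ω h
    calc ‖∑ i, X i ω‖ ≤ ∑ _i : Fin n, M := norm_sum_le_of_le _ fun i _ => h i
      _ = n * M := by simp
  refine le_trans (measure_mono fun ω hω => ?_) (measure_lt_le_of_integral_exp_le
    (integrable_exp_mul_sq_norm (Finset.aemeasurable_fun_sum _ fun i _ => hX i) hSb
      (by positivity)) key ha)
  simp only [Set.mem_ofPred_eq] at hω ⊢
  rw [one_div_mul_eq_div, lt_div_iff₀ (by positivity)]
  linarith

end Concentration

/-! ### Tail of the norm of the Gaussian noise. -/

section Gaussian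

/-- Both characteristic functions are `exp(-τ²‖t‖²/2)`, which also covers the degenerate case `τ =
0`. -/
lemma gaussianNoise_eq_map (d : ℕ) (τ : ℝ) :
    gaussianNoise d τ = (stdGaussian (Vec d)).map (fun x => τ • x) := by
  have hps : ((τ ^ 2) • (1 : Matrix (Fin d) (Fin d) ℝ)).PosSemidef :=
    Matrix.PosSemidef.one.smul (sq_nonneg τ)
  have : IsProbabilityMeasure ((stdGaussian (Vec d)).map (fun x => τ • x)) :=
    Measure.isProbabilityMeasure_map (by fun_prop)
  unfold gaussianNoise
  apply Measure.ext_of_charFun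
  ext t
  rw [charFun_multivariateGaussian hps, charFun_map_smul, charFun_stdGaussian, norm_smul]
  simp only [inner_zero_right, Matrix.smul_mulVec, Matrix.one_mulVec, dotProduct_smul]
  congr 1
  have : t.ofLp ⬝ᵥ t.ofLp = ‖t‖ ^ 2 := by
    rw [EuclideanSpace.real_norm_sq_eq]
    simp [dotProduct, sq]
  rw [this]
  rw [← Complex.ofReal_pow, mul_pow, Real.norm_eq_abs, sq_abs]
  simp [neg_div]

lemma integral_exp_sq_div_four_gaussianReal :
    ∫ x, Real.exp (x ^ 2 / 4) ∂(gaussianReal 0 1) = Real.sqrt 2 := by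
  rw [integral_gaussianReal_eq_integral_smul one_ne_zero]
  have : ∀ x : ℝ, gaussianPDFReal 0 1 x • Real.exp (x ^ 2 / 4) =
      (Real.sqrt (2 * Real.pi))⁻¹ * Real.exp (-(1 / 4) * x ^ 2) := fun x => by
    simp only [gaussianPDFReal, smul_eq_mul, NNReal.coe_one, mul_one, sub_zero]
    rw [mul_assoc, ← Real.exp_add]
    ring_nf
  simp_rw [this]
  rw [integral_const_mul, integral_gaussian, ← Real.sqrt_inv, ← Real.sqrt_mul (by positivity)]
  congr 1
  have := Real.pi_pos
  field_simp
  norm_num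

lemma integrable_exp_sq_div_four_gaussianReal :
    Integrable (fun x => Real.exp (x ^ 2 / 4)) (gaussianReal 0 1) := by
  -- A non-integrable function has Bochner integral `0`, whereas the integral was computed to be
  -- `√2`.
  by_contra h
  have h1 := integral_exp_sq_div_four_gaussianReal
  rw [integral_undef h] at h1
  have : (0 : ℝ) < Real.sqrt 2 := by positivity
  linarith

lemma exp_sq_norm_toLp {d : ℕ} (x : Fin d → ℝ) :
    Real.exp (‖(WithLp.toLp 2 x : Vec d)‖ ^ 2 / 4) = ∏ i, Real.exp (x i ^ 2 / 4) := by
  rw [EuclideanSpace.real_norm_sq_eq, ← Real.exp_sum, Finset.sum_div]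

lemma integrable_exp_sq_norm_stdGaussian (d : ℕ) :
    Integrable (fun x : Vec d => Real.exp (‖x‖ ^ 2 / 4)) (stdGaussian (Vec d)) := by
  rw [← map_pi_eq_stdGaussian, integrable_map_measure (by fun_prop) (by fun_prop)]
  simp only [Function.comp_def, exp_sq_norm_toLp]
  exact Integrable.fintype_prod fun _ => integrable_exp_sq_div_four_gaussianReal

lemma integral_exp_sq_norm_stdGaussian (d : ℕ) :
    ∫ x : Vec d, Real.exp (‖x‖ ^ 2 / 4) ∂(stdGaussian (Vec d)) = Real.exp (d / 2 * Real.log 2) := by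
  rw [← map_pi_eq_stdGaussian, integral_map (by fun_prop) (by fun_prop)]
  simp only [exp_sq_norm_toLp]
  rw [integral_fintype_prod_eq_prod (f := fun _ x => Real.exp (x ^ 2 / 4))]
  simp only [integral_exp_sq_div_four_gaussianReal, Finset.prod_const, Finset.card_univ,
    Fintype.card_fin]
  rw [Real.sqrt_eq_rpow, Real.rpow_def_of_pos (by norm_num), ← Real.exp_nat_mul]
  ring_nf

lemma measure_norm_gaussianNoise_gt_le {Ω : Type*} [MeasurableSpace Ω] {P : Measure Ω} {d : ℕ}
    {τ : ℝ} (hτ : 0 ≤ τ) {w : Ω → Vec d} (hw : HasLaw w (gaussianNoise d τ) P) {a : ℝ}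
    (ha : 0 < a) :
    P {ω | τ * Real.sqrt (4 * (d / 2 * Real.log 2 + Real.log (1 / a))) < ‖w ω‖} ≤
      ENNReal.ofReal a := by
  set T := τ * Real.sqrt (4 * (d / 2 * Real.log 2 + Real.log (1 / a)))
  have hms : MeasurableSet {x : Vec d | T < ‖x‖} := measurableSet_lt (by fun_prop) (by fun_prop)
  calc P {ω | T < ‖w ω‖} = gaussianNoise d τ {x | T < ‖x‖} := by
        rw [← hw.map_eq, Measure.map_apply_of_aemeasurable hw.aemeasurable hms]
        rfl
    _ = stdGaussian (Vec d) {x | T < ‖τ • x‖} := by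
        rw [gaussianNoise_eq_map, Measure.map_apply (by fun_prop) hms]
        rfl
    _ ≤ stdGaussian (Vec d) {x | d / 2 * Real.log 2 + Real.log (1 / a) < ‖x‖ ^ 2 / 4} := by
        refine measure_mono fun x hx => ?_
        simp only [Set.mem_ofPred_eq, norm_smul, Real.norm_of_nonneg hτ] at hx ⊢
        have := Real.lt_sq_of_sqrt_lt (lt_of_mul_lt_mul_left hx hτ)
        linarith
    _ ≤ ENNReal.ofReal a :=
        measure_lt_le_of_integral_exp_le (integrable_exp_sq_norm_stdGaussian d)
          (integral_exp_sq_norm_stdGaussian d).le ha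

end Gaussian

/-! ### Curvature of the logistic loss. -/

section Logistic

lemma gammaCoef_pos (L B : ℝ) : 0 < gammaCoef L B := by
  unfold gammaCoef; positivity

lemma sigmoid_mul_one_sub_sigmoid (z : ℝ) :
    Real.sigmoid z * (1 - Real.sigmoid z) = 1 / (2 + 2 * Real.cosh z) := by
  rw [← Real.sigmoid_neg, Real.sigmoid_def, Real.sigmoid_def, neg_neg, Real.cosh_eq, ← mul_inv,
    one_div]
  congr 1
  have : Real.exp z * Real.exp (-z) = 1 := by rw [← Real.exp_add]; simp
  linear_combination this

/-- The derivative of the sigmoid is `1/(2 + 2 cosh z)`, decreasing in `|z|`, and `γ` is its value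
at the endpoint `2LB`. -/
lemma gammaCoef_le_sigmoid_mul {L B z : ℝ} (hz : |z| ≤ 2 * L * B) :
    gammaCoef L B ≤ Real.sigmoid z * (1 - Real.sigmoid z) := by
  have h : gammaCoef L B = 1 / (2 + 2 * Real.cosh (2 * L * B)) := by
    rw [gammaCoef, Real.cosh_eq]
    ring_nf
  rw [sigmoid_mul_one_sub_sigmoid, h]
  have hc : Real.cosh z ≤ Real.cosh (2 * L * B) :=
    Real.cosh_le_cosh.2 (hz.trans (le_abs_self _))
  have : 0 < Real.cosh z := Real.cosh_pos z
  gcongr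

/-- Strong convexity of the logistic loss on `[-2LB, 2LB]`. -/
lemma neg_log_sigmoid_ge {L B z₀ z : ℝ} (h₀ : |z₀| ≤ 2 * L * B) (hz : |z| ≤ 2 * L * B) :
    -Real.log (Real.sigmoid z₀) + (Real.sigmoid z₀ - 1) * (z - z₀) +
      gammaCoef L B / 2 * (z - z₀) ^ 2 ≤ -Real.log (Real.sigmoid z) := by
  set g := gammaCoef L B
  have hsd : ∀ t, HasDerivAt Real.sigmoid (Real.sigmoid t * (1 - Real.sigmoid t)) t :=
    Real.hasDerivAt_sigmoid
  have hkd : ∀ t, HasDerivAt (fun t => Real.sigmoid t - g * t)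
      (Real.sigmoid t * (1 - Real.sigmoid t) - g * 1) t := fun t =>
    (hsd t).sub ((hasDerivAt_id' t).const_mul g)
  have hmono : MonotoneOn (fun t => Real.sigmoid t - g * t) (Set.Icc (-(2 * L * B)) (2 * L * B)) := by
    refine monotoneOn_of_deriv_nonneg (convex_Icc _ _)
      (fun t _ => (hkd t).continuousAt.continuousWithinAt)
      (fun t _ => (hkd t).differentiableAt.differentiableWithinAt) fun t ht => ?_
    rw [(hkd t).deriv]
    have ht' := interior_subset ht
    have := gammaCoef_le_sigmoid_mul (L := L) (B := B) (abs_le.2 ht')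
    linarith
  -- The gap between the loss and its quadratic minorant has derivative `h(t) - h(z₀)`, with `h(t) =
  -- ς(t) - γt` increasing on the interval, so the gap is minimal at `z₀`.
  have hd : ∀ t, HasDerivAt (fun t => -Real.log (Real.sigmoid t) - (Real.sigmoid z₀ - 1) * (t - z₀) -
      g / 2 * (t - z₀) ^ 2) ((Real.sigmoid t - g * t) - (Real.sigmoid z₀ - g * z₀)) t := fun t => by
    have h1 := ((hsd t).log (Real.sigmoid_pos t).ne').neg
    have h2 := ((hasDerivAt_id' t).sub_const z₀)
    refine ((h1.sub (h2.const_mul (Real.sigmoid z₀ - 1))).sub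
      ((h2.pow 2).const_mul (g / 2))).congr_deriv ?_
    have := (Real.sigmoid_pos t).ne'
    field_simp
    ring
  rw [abs_le] at h₀ hz
  suffices h : (fun t => -Real.log (Real.sigmoid t) - (Real.sigmoid z₀ - 1) * (t - z₀) -
      g / 2 * (t - z₀) ^ 2) z₀ ≤ (fun t => -Real.log (Real.sigmoid t) -
      (Real.sigmoid z₀ - 1) * (t - z₀) - g / 2 * (t - z₀) ^ 2) z by
    simp only [sub_self, mul_zero] at h
    linarith
  rcases le_total z₀ z with hle | hle
  · refine (monotoneOn_of_deriv_nonneg (convex_Icc z₀ z)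
      (fun t _ => (hd t).continuousAt.continuousWithinAt)
      (fun t _ => (hd t).differentiableAt.differentiableWithinAt) fun t ht => ?_)
      (Set.left_mem_Icc.2 hle) (Set.right_mem_Icc.2 hle) hle
    rw [(hd t).deriv]
    have ht := interior_subset ht
    exact sub_nonneg.2 (hmono h₀ ⟨h₀.1.trans ht.1, ht.2.trans hz.2⟩ ht.1)
  · refine (antitoneOn_of_deriv_nonpos (convex_Icc z z₀)
      (fun t _ => (hd t).continuousAt.continuousWithinAt)
      (fun t _ => (hd t).differentiableAt.differentiableWithinAt) fun t ht => ?_)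
      (Set.left_mem_Icc.2 hle) (Set.right_mem_Icc.2 hle) hle
    rw [(hd t).deriv]
    have ht := interior_subset ht
    exact sub_nonpos.2 (hmono ⟨hz.1.trans ht.1, ht.2.trans h₀.2⟩ h₀ ht.2)

lemma two_mul_mul_gammaCoef_le (L B : ℝ) : 2 * L * B * gammaCoef L B ≤ 1 := by
  rw [gammaCoef, mul_one_div, div_le_one (by positivity)]
  have := Real.add_one_le_exp (2 * L * B)
  have := Real.exp_pos (-2 * L * B)
  linarith

end Logistic

/-! ### Score and basic inequality. -/

section Estimator

variable {S A : Type*} {d n : ℕ} {φ : S → A → Vec d} {L B : ℝ}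

lemma norm_diffFeature_le (hL : ∀ s a, ‖φ s a‖ ≤ L) (p : S × (A × A)) :
    ‖diffFeature φ p‖ ≤ 2 * L := by
  unfold diffFeature
  linarith [norm_sub_le (φ p.1 p.2.2) (φ p.1 p.2.1), hL p.1 p.2.2, hL p.1 p.2.1]

lemma abs_inner_diffFeature_le (hL : ∀ s a, ‖φ s a‖ ≤ L) (p : S × (A × A)) {θ : Vec d}
    (hθ : θ ∈ paramSet d B) : |inner ℝ (diffFeature φ p) θ| ≤ 2 * L * B := by
  have h := norm_diffFeature_le hL p
  have h0 : 0 ≤ 2 * L := (norm_nonneg _).trans h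
  exact (abs_real_inner_le_norm _ _).trans (mul_le_mul h hθ.2 (norm_nonneg _) h0)

/-- The gradient in `θ` of the negative log-likelihood of one sample. -/
noncomputable def score (φ : S → A → Vec d) (θ : Vec d) (z : Sample S A) : Vec d :=
  (if z.2 then Real.sigmoid (inner ℝ (diffFeature φ z.1) θ) - 1
    else Real.sigmoid (inner ℝ (diffFeature φ z.1) θ)) • diffFeature φ z.1

lemma norm_score_le (hL : ∀ s a, ‖φ s a‖ ≤ L) (θ : Vec d) (z : Sample S A) :
    ‖score φ θ z‖ ≤ 2 * L := by
  have h := norm_diffFeature_le hL z.1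
  have h1 := Real.sigmoid_pos (inner ℝ (diffFeature φ z.1) θ)
  have h2 := Real.sigmoid_lt_one (inner ℝ (diffFeature φ z.1) θ)
  rw [score, norm_smul]
  refine (mul_le_of_le_one_left (norm_nonneg _) ?_).trans h
  rw [Real.norm_eq_abs, abs_le]
  split_ifs <;> constructor <;> linarith

lemma negLogLik_ge (hL : ∀ s a, ‖φ s a‖ ≤ L) (D : Fin n → Sample S A) {θ₀ θ : Vec d}
    (h₀ : θ₀ ∈ paramSet d B) (hθ : θ ∈ paramSet d B) :
    negLogLik φ D θ₀ + inner ℝ (∑ i, score φ θ₀ (D i)) (θ - θ₀) +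
      gammaCoef L B / 2 * ∑ i, (inner ℝ (diffFeature φ (D i).1) (θ - θ₀)) ^ 2 ≤
      negLogLik φ D θ := by
  unfold negLogLik
  rw [sum_inner, Finset.mul_sum, ← Finset.sum_neg_distrib, ← Finset.sum_neg_distrib,
    ← Finset.sum_add_distrib, ← Finset.sum_add_distrib]
  refine Finset.sum_le_sum fun i _ => ?_
  have a0 := abs_inner_diffFeature_le hL (D i).1 h₀
  have a1 := abs_inner_diffFeature_le hL (D i).1 hθ
  rw [score, real_inner_smul_left, inner_sub_right]
  cases (D i).2
  -- Label `0` reduces to label `1` by the symmetry `1 - ς(z) = ς(-z)`.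
  · have := neg_log_sigmoid_ge (L := L) (B := B) (z₀ := -inner ℝ (diffFeature φ (D i).1) θ₀)
      (z := -inner ℝ (diffFeature φ (D i).1) θ) (by rwa [abs_neg]) (by rwa [abs_neg])
    rw [Real.sigmoid_neg, Real.sigmoid_neg] at this
    simp only [Bool.false_eq_true, if_false]
    linarith
  · simpa using neg_log_sigmoid_ge a0 a1

/-- The basic inequality for the perturbed constrained estimator. -/
lemma IsObjEstimate.basic_inequality (hL : ∀ s a, ‖φ s a‖ ≤ L) {D : Fin n → Sample S A}
    {w θ₀ θ : Vec d} {β : ℝ} (hβ : 0 ≤ β) (h₀ : θ₀ ∈ paramSet d B)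
    (hest : IsObjEstimate φ B β D w θ) :
    gammaCoef L B / 2 * ∑ i, (inner ℝ (diffFeature φ (D i).1) (θ - θ₀)) ^ 2 ≤
      ‖θ - θ₀‖ * (‖∑ i, score φ θ₀ (D i)‖ + β * B + ‖w‖) := by
  have hmin : objective φ β D w θ ≤ objective φ β D w θ₀ := hest.2 h₀
  have hll := negLogLik_ge hL D h₀ hest.1
  unfold objective at hmin
  have hsq : ‖θ‖ ^ 2 = ‖θ₀‖ ^ 2 + 2 * inner ℝ θ₀ (θ - θ₀) + ‖θ - θ₀‖ ^ 2 := by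
    rw [← norm_add_sq_real]; simp
  have h1 := neg_le_of_abs_le (abs_real_inner_le_norm (∑ i, score φ θ₀ (D i)) (θ - θ₀))
  have h2 := neg_le_of_abs_le (abs_real_inner_le_norm w (θ - θ₀))
  have h3 := neg_le_of_abs_le (abs_real_inner_le_norm θ₀ (θ - θ₀))
  have h4 : ‖θ₀‖ * ‖θ - θ₀‖ ≤ B * ‖θ - θ₀‖ := by
    gcongr
    exact h₀.2
  rw [inner_sub_right w] at h2
  -- The linear part of the ridge penalty costs the bias `βB`; its quadratic part is nonnegative and
  -- is dropped.
  have h5 : β * (-(B * ‖θ - θ₀‖)) ≤ β * inner ℝ θ₀ (θ - θ₀) := by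
    gcongr
    linarith
  have h6 : 0 ≤ β / 2 * ‖θ - θ₀‖ ^ 2 := by positivity
  rw [hsq] at hmin
  linarith

end Estimator

/-! ### Rank-one tensors and the eigenvalue condition. -/

section Outer

variable {d : ℕ}

/-- The rank-one tensor `x ⊗ x`, as a vector with the Frobenius norm. -/
noncomputable def outer (x : Vec d) : EuclideanSpace ℝ (Fin d × Fin d) :=
  WithLp.toLp 2 fun q => x q.1 * x q.2

lemma inner_outer (u : EuclideanSpace ℝ (Fin d × Fin d)) (v : Vec d) :
    inner ℝ u (outer v) = ∑ i, ∑ j, u (i, j) * (v i * v j) := by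
  rw [PiLp.inner_apply, Fintype.sum_prod_type]
  simp [outer, mul_comm]

lemma inner_outer_outer (x v : Vec d) : inner ℝ (outer x) (outer v) = (inner ℝ x v) ^ 2 := by
  rw [inner_outer, PiLp.inner_apply, sq, Finset.sum_mul_sum]
  refine Finset.sum_congr rfl fun i _ => Finset.sum_congr rfl fun j _ => ?_
  simp [outer]
  ring

lemma norm_outer (x : Vec d) : ‖outer x‖ = ‖x‖ ^ 2 := by
  have h : ‖outer x‖ ^ 2 = (‖x‖ ^ 2) ^ 2 := by
    rw [← real_inner_self_eq_norm_sq, inner_outer_outer, real_inner_self_eq_norm_sq]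
  exact (pow_left_inj₀ (norm_nonneg _) (sq_nonneg _) two_ne_zero).1 h

lemma continuous_outer : Continuous (outer : Vec d → _) := by
  unfold outer; fun_prop

/-- An eigenvalue of `M - κI` is an eigenvalue of `M` shifted by `-κ`, so `M - κI` is positive
semidefinite by the spectral theorem. -/
lemma MinEigenvalueGe.mul_sq_norm_le {M : Matrix (Fin d) (Fin d) ℝ} {κ : ℝ}
    (h : MinEigenvalueGe M κ) (hM : M.IsHermitian) (v : Vec d) :
    κ * ‖v‖ ^ 2 ≤ ∑ i, ∑ j, M i j * (v i * v j) := by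
  have hH : (M - κ • (1 : Matrix (Fin d) (Fin d) ℝ)).IsHermitian := by
    refine hM.sub ?_
    simp [Matrix.IsHermitian]
  have hps : (M - κ • (1 : Matrix (Fin d) (Fin d) ℝ)).PosSemidef := by
    rw [hH.posSemidef_iff_eigenvalues_nonneg]
    intro i
    have hv := hH.mulVec_eigenvectorBasis i
    have hne : (hH.eigenvectorBasis i).ofLp ≠ 0 := fun h0 =>
      hH.eigenvectorBasis.orthonormal.ne_zero i (by ext j; exact congrFun h0 j)
    rw [Matrix.sub_mulVec, Matrix.smul_mulVec, Matrix.one_mulVec] at hv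
    have := h (hH.eigenvalues i + κ) (Module.End.hasEigenvalue_of_hasEigenvector
      (Module.End.hasEigenvector_iff.2 ⟨Module.End.mem_eigenspace_iff.2 (by
        rw [Matrix.toLin'_apply, add_smul, ← hv]; simp), hne⟩))
    simp only [Pi.zero_apply]
    linarith
  have h0 := hps.dotProduct_mulVec_nonneg v.ofLp
  have e1 : v.ofLp ⬝ᵥ v.ofLp = ‖v‖ ^ 2 := by
    rw [EuclideanSpace.real_norm_sq_eq]
    simp [dotProduct, sq]
  have e2 : v.ofLp ⬝ᵥ M.mulVec v.ofLp = ∑ i, ∑ j, M i j * (v i * v j) := by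
    simp only [dotProduct, Matrix.mulVec, Finset.mul_sum]
    refine Finset.sum_congr rfl fun i _ => Finset.sum_congr rfl fun j _ => by ring
  rw [star_trivial, Matrix.sub_mulVec, Matrix.smul_mulVec, Matrix.one_mulVec, dotProduct_sub,
    dotProduct_smul, e1, e2, smul_eq_mul] at h0
  linarith

end Outer

/-! ### Scores and second moments under the sampling law. -/

section Model

variable {S A : Type*} [MeasurableSpace S] [MeasurableSpace A] {d : ℕ} {φ : S → A → Vec d}
  {ρ : Measure S} {μ : Kernel S (A × A)} {L κ : ℝ}

lemma measurable_diffFeature (hφ : Measurable (Function.uncurry φ)) :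
    Measurable (diffFeature φ) :=
  (hφ.comp (measurable_fst.prodMk (measurable_snd.comp measurable_snd))).sub
    (hφ.comp (measurable_fst.prodMk (measurable_fst.comp measurable_snd)))

lemma measurable_score (hφ : Measurable (Function.uncurry φ)) (θ : Vec d) :
    Measurable (score φ θ) := by
  have hx := measurable_diffFeature hφ
  have hs : Measurable fun p => Real.sigmoid (inner ℝ (diffFeature φ p) θ) :=
    continuous_sigmoid.measurable.comp (hx.inner measurable_const)
  refine measurable_from_prod_countable_left fun l => ?_
  cases l
  · simp only [score, Bool.false_eq_true, if_false]
    exact hs.smul hx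
  · simp only [score, if_true]
    exact (hs.sub_const 1).smul hx

omit [MeasurableSpace S] [MeasurableSpace A] in
lemma btlProb_true (φ : S → A → Vec d) (θ : Vec d) (p : S × (A × A)) :
    btlProb φ θ p true = Real.sigmoid (inner ℝ (diffFeature φ p) θ) := by
  simp only [btlProb, if_true, diffFeature, inner_sub_left, Real.sigmoid_def, reward, neg_sub,
    Real.exp_sub]
  have := Real.exp_pos (inner ℝ (φ p.1 p.2.2) θ)
  have := Real.exp_pos (inner ℝ (φ p.1 p.2.1) θ)
  field_simp
  ring

lemma labelKernel_real_singleton (hφ : Measurable (Function.uncurry φ)) (θ : Vec d)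
    (p : S × (A × A)) (l : Bool) : (labelKernel φ θ p).real {l} = btlProb φ θ p l := by
  have hm : Measurable (Function.uncurry fun p l => ENNReal.ofReal (btlProb φ θ p l)) :=
    (measurable_btlProb hφ θ).ennreal_ofReal
  rw [measureReal_def, labelKernel, Kernel.withDensity_apply _ hm,
    withDensity_apply _ (measurableSet_singleton l)]
  simp [Kernel.const_apply, ENNReal.toReal_ofReal (btlProb_nonneg φ θ p l)]

/-- The score at the true parameter is centred. -/
lemma integral_score_sampleLaw [IsProbabilityMeasure ρ] [IsMarkovKernel μ]
    (hφ : Measurable (Function.uncurry φ)) (hL : ∀ s a, ‖φ s a‖ ≤ L) (θ : Vec d) :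
    ∫ z, score φ θ z ∂(sampleLaw ρ μ φ θ) = 0 := by
  have := isMarkovKernel_labelKernel hφ θ
  have hi : Integrable (score φ θ) ((ρ.compProd μ).compProd (labelKernel φ θ)) :=
    Integrable.of_bound (C := 2 * L) (measurable_score hφ θ).aestronglyMeasurable
      (Filter.Eventually.of_forall fun z => norm_score_le hL θ z)
  rw [sampleLaw, Measure.integral_compProd hi]
  -- The mean vanishes already given `(s, a⁰, a¹)`: with `p` the probability of label `1`, the
  -- coefficient of `x` is `p(p - 1) + (1 - p)p = 0`.
  refine integral_eq_zero_of_ae (Filter.Eventually.of_forall fun p => ?_)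
  simp only [Pi.zero_apply]
  rw [integral_fintype (Integrable.of_finite), Fintype.sum_bool,
    labelKernel_real_singleton hφ, labelKernel_real_singleton hφ]
  have h := btlProb_add φ θ p
  rw [btlProb_true] at h ⊢
  simp only [score, if_true, Bool.false_eq_true, if_false, smul_smul, ← add_smul]
  rw [eq_sub_of_add_eq' h]
  ring_nf
  simp

/-- The population second moment `E[x ⊗ x]`. -/
noncomputable def meanOuter (ρ : Measure S) (μ : Kernel S (A × A)) (φ : S → A → Vec d) :
    EuclideanSpace ℝ (Fin d × Fin d) :=
  ∫ p, outer (diffFeature φ p) ∂(ρ.compProd μ)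

omit [MeasurableSpace S] [MeasurableSpace A] in
lemma norm_outer_diffFeature_le (hL : ∀ s a, ‖φ s a‖ ≤ L) (p : S × (A × A)) :
    ‖outer (diffFeature φ p)‖ ≤ 4 * L ^ 2 := by
  rw [norm_outer]
  calc ‖diffFeature φ p‖ ^ 2 ≤ (2 * L) ^ 2 := by
        gcongr
        exact norm_diffFeature_le hL p
    _ = 4 * L ^ 2 := by ring

variable [IsProbabilityMeasure ρ] [IsMarkovKernel μ]

lemma integrable_outer_diffFeature (hφ : Measurable (Function.uncurry φ))
    (hL : ∀ s a, ‖φ s a‖ ≤ L) :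
    Integrable (fun p => outer (diffFeature φ p)) (ρ.compProd μ) :=
  Integrable.of_bound (C := 4 * L ^ 2)
    (continuous_outer.measurable.comp (measurable_diffFeature hφ)).aestronglyMeasurable
    (Filter.Eventually.of_forall fun p => norm_outer_diffFeature_le hL p)

lemma norm_meanOuter_le (hL : ∀ s a, ‖φ s a‖ ≤ L) : ‖meanOuter ρ μ φ‖ ≤ 4 * L ^ 2 := by
  have := norm_integral_le_of_norm_le_const (μ := ρ.compProd μ)
    (Filter.Eventually.of_forall fun p => norm_outer_diffFeature_le hL p)
  simpa [meanOuter] using this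

lemma meanOuter_apply (hφ : Measurable (Function.uncurry φ)) (hL : ∀ s a, ‖φ s a‖ ≤ L)
    (i j : Fin d) : meanOuter ρ μ φ (i, j) = popCov ρ μ φ i j := by
  have h := (EuclideanSpace.proj (𝕜 := ℝ) (i, j)).integral_comp_comm
    (integrable_outer_diffFeature (ρ := ρ) (μ := μ) hφ hL)
  exact h.symm

lemma mul_sq_norm_le_inner_meanOuter (hφ : Measurable (Function.uncurry φ))
    (hL : ∀ s a, ‖φ s a‖ ≤ L) (hcov : MinEigenvalueGe (popCov ρ μ φ) κ) (v : Vec d) :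
    κ * ‖v‖ ^ 2 ≤ inner ℝ (meanOuter ρ μ φ) (outer v) := by
  have hH : (popCov ρ μ φ).IsHermitian := by
    ext i j
    simp [popCov, Matrix.conjTranspose_apply, mul_comm]
  rw [inner_outer]
  simp only [meanOuter_apply hφ hL]
  exact hcov.mul_sq_norm_le hH v

/-- Since `⟨x ⊗ x, v ⊗ v⟩ = ⟨x, v⟩²`, pairing the total deviation with `v ⊗ v` compares the
empirical and population quadratic forms; Cauchy–Schwarz in Frobenius norm bounds the loss. -/
lemma sum_sq_inner_ge {n : ℕ} (hφ : Measurable (Function.uncurry φ))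
    (hL : ∀ s a, ‖φ s a‖ ≤ L) (hcov : MinEigenvalueGe (popCov ρ μ φ) κ)
    (D : Fin n → Sample S A) (v : Vec d) :
    (n * κ - ‖∑ i, (outer (diffFeature φ (D i).1) - meanOuter ρ μ φ)‖) * ‖v‖ ^ 2 ≤
      ∑ i, (inner ℝ (diffFeature φ (D i).1) v) ^ 2 := by
  have h1 := mul_sq_norm_le_inner_meanOuter hφ hL hcov v
  have h2 := neg_le_of_abs_le (abs_real_inner_le_norm
    (∑ i, (outer (diffFeature φ (D i).1) - meanOuter ρ μ φ)) (outer v))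
  rw [norm_outer, sum_inner] at h2
  set N := ‖∑ i, (outer (diffFeature φ (D i).1) - meanOuter ρ μ φ)‖
  simp only [inner_sub_left, inner_outer_outer, Finset.sum_sub_distrib, Finset.sum_const,
    Finset.card_univ, Fintype.card_fin, nsmul_eq_mul] at h2
  have h3 : (n : ℝ) * (κ * ‖v‖ ^ 2) ≤ n * inner ℝ (meanOuter ρ μ φ) (outer v) := by gcongr
  linarith

end Model

/-! ### Deviation bounds for the data. -/

section Deviation

variable {S A : Type*} [MeasurableSpace S] [MeasurableSpace A] {d n : ℕ} {φ : S → A → Vec d}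
  {ρ : Measure S} {μ : Kernel S (A × A)} [IsProbabilityMeasure ρ] [IsMarkovKernel μ] {L : ℝ}
  {Ω : Type*} [MeasurableSpace Ω] {P : Measure Ω} [IsProbabilityMeasure P]
  {D : Fin n → Ω → Sample S A} {θ : Vec d}

lemma measure_norm_sum_score_gt_le (hn : 0 < n) (hφ : Measurable (Function.uncurry φ))
    (hLpos : 0 < L) (hL : ∀ s a, ‖φ s a‖ ≤ L)
    (hD : ∀ i, HasLaw (D i) (sampleLaw ρ μ φ θ) P) (hind : iIndepFun D P) {a : ℝ} (ha : 0 < a) :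
    P {ω | 4 * n * (2 * L) ^ 2 * (1 / 2 + Real.log (1 / a)) < ‖∑ i, score φ θ (D i ω)‖ ^ 2} ≤
      ENNReal.ofReal a := by
  have hm := measurable_score hφ θ
  refine measure_norm_sum_gt_le hn (X := fun i ω => score φ θ (D i ω))
    (fun i => hm.comp_aemeasurable (hD i).aemeasurable)
    (hind.comp (fun _ => score φ θ) fun _ => hm) (by positivity)
    (fun i => Filter.Eventually.of_forall fun ω => norm_score_le hL θ _) (fun i => ?_) ha
  rw [← integral_score_sampleLaw (ρ := ρ) (μ := μ) hφ hL θ, ← (hD i).map_eq,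
    integral_map (hD i).aemeasurable hm.aestronglyMeasurable]

lemma measure_norm_sum_outer_gt_le (hn : 0 < n) (hφ : Measurable (Function.uncurry φ))
    (hLpos : 0 < L) (hL : ∀ s a, ‖φ s a‖ ≤ L)
    (hD : ∀ i, HasLaw (D i) (sampleLaw ρ μ φ θ) P) (hind : iIndepFun D P) {a : ℝ} (ha : 0 < a) :
    P {ω | 4 * n * (8 * L ^ 2) ^ 2 * (1 / 2 + Real.log (1 / a)) <
        ‖∑ i, (outer (diffFeature φ (D i ω).1) - meanOuter ρ μ φ)‖ ^ 2} ≤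
      ENNReal.ofReal a := by
  have hm0 : Measurable fun p => outer (diffFeature φ p) :=
    continuous_outer.measurable.comp (measurable_diffFeature hφ)
  have hm : Measurable fun z : Sample S A => outer (diffFeature φ z.1) - meanOuter ρ μ φ :=
    (hm0.comp measurable_fst).sub_const _
  refine measure_norm_sum_gt_le hn
    (X := fun i ω => outer (diffFeature φ (D i ω).1) - meanOuter ρ μ φ)
    (fun i => hm.comp_aemeasurable (hD i).aemeasurable)
    (hind.comp (fun _ z => outer (diffFeature φ z.1) - meanOuter ρ μ φ) fun _ => hm)
    (by positivity) (fun i => Filter.Eventually.of_forall fun ω => ?_) (fun i => ?_) ha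
  · have h1 := norm_outer_diffFeature_le hL (D i ω).1
    have h2 := norm_meanOuter_le (ρ := ρ) (μ := μ) hL
    have h3 := norm_sub_le (outer (diffFeature φ (D i ω).1)) (meanOuter ρ μ φ)
    linarith
  · have := isMarkovKernel_labelKernel hφ θ
    -- The label kernel is Markov, so forgetting the label recovers the law of the features.
    have hfst : P.map (fun ω => (D i ω).1) = ρ.compProd μ := by
      rw [← Measure.fst_compProd (ρ.compProd μ) (labelKernel φ θ), ← sampleLaw, ← (hD i).map_eq,
        Measure.fst, AEMeasurable.map_map_of_aemeasurable (by fun_prop) (hD i).aemeasurable]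
      rfl
    have hDm : AEMeasurable (fun ω => (D i ω).1) P := (hD i).aemeasurable.fst
    have hi : Integrable (fun ω => outer (diffFeature φ (D i ω).1)) P := by
      have := integrable_outer_diffFeature (ρ := ρ) (μ := μ) hφ hL
      rw [← hfst] at this
      exact this.comp_aemeasurable hDm
    rw [integral_sub hi (integrable_const _), integral_const, meanOuter, ← hfst,
      integral_map hDm hm0.aestronglyMeasurable]
    simp

end Deviation

/-! ### Assembling the error bound. -/

section MainBound

/-- Deterministic error bound on the event where the score `t`, the deviation `N` of the empirical
second moment and the noise `W` are controlled. -/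
lemma error_le_of_bounds {n K κ L B g N W β s t x q r b : ℝ} (hr : n = r ^ 2)
    (hr0 : 0 < r) (hκ : 0 < κ) (hL : 0 < L) (hg : 0 < g) (hK : 0 < K) (hgB : 2 * L * B * g ≤ 1)
    (hx0 : 0 ≤ x) (hxB : x ≤ 2 * B) (hq : 1 ≤ q) (hβ : β * B ≤ K * L * r) (hb : 0 ≤ b)
    (hs : t ≤ 8 * L * r * q) (hN : N ≤ 32 * L ^ 2 * r * q) (hW : W ≤ 4 * b)
    (hbasic : g / 2 * s ≤ x * (t + β * B + W)) (hcov : (n * κ - N) * x ^ 2 ≤ s) :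
    x ≤ (64 + 4 * K) * (L / (κ * g) * (q / r) + b / (n * κ * g)) := by
  have hq0 : 0 < q := by linarith
  have hLrq : 0 < L * r * q := by positivity
  have hKL : K * L * r ≤ K * L * r * q := le_mul_of_one_le_right (by positivity) hq
  have e : (64 + 4 * K) * (L / (κ * g) * (q / r) + b / (n * κ * g)) =
      (64 + 4 * K) * (L * r * q + b) / (n * κ * g) := by
    rw [hr]
    field_simp
  have hn : 0 < n := by rw [hr]; positivity
  rw [e, le_div_iff₀ (by positivity)]
  have hKLrq : 0 < K * (L * r * q) := by positivity
  have hKb : 0 ≤ K * b := by positivity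
  -- Either the empirical second moment keeps half of the population curvature, or `nκ < 64L²rq` and
  -- the diameter bound `x ≤ 2B` suffices.
  rcases le_or_gt N (n * κ / 2) with hA | hA
  · rcases hx0.eq_or_lt with hx | hx
    · rw [← hx, zero_mul]
      positivity
    have h1 : n * κ / 2 * x ^ 2 ≤ s := by
      refine le_trans ?_ hcov
      gcongr
      linarith
    have h2 : g / 2 * (n * κ / 2 * x ^ 2) ≤ x * (8 * L * r * q + K * L * r * q + 4 * b) := by
      calc g / 2 * (n * κ / 2 * x ^ 2) ≤ g / 2 * s := by gcongr
        _ ≤ _ := hbasic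
        _ ≤ _ := mul_le_mul_of_nonneg_left (by linarith) hx.le
    have h3 : x * (x * (n * κ * g)) ≤ x * (4 * (8 * L * r * q + K * L * r * q + 4 * b)) := by
      linarith
    have h4 := le_of_mul_le_mul_left h3 hx
    linarith
  · have h1 : r * (r * κ) ≤ r * (64 * L ^ 2 * q) := by
      rw [hr] at hA
      linarith
    -- The extra factor `L` lets `2LBg ≤ 1` eliminate `B`.
    have h3 : L * (x * (n * κ * g)) ≤ L * (64 * (L * r * q)) := by
      calc L * (x * (n * κ * g)) ≤ L * (2 * B * (n * κ * g)) := by gcongr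
        _ = (2 * L * B * g) * (r * (r * κ)) := by rw [hr]; ring
        _ ≤ 1 * (r * (r * κ)) := by gcongr
        _ ≤ L * (64 * (L * r * q)) := by linarith
    have h4 := le_of_mul_le_mul_left h3 hL
    linarith

variable {S A : Type*} [MeasurableSpace S] [MeasurableSpace A] {d n : ℕ} {φ : S → A → Vec d}
  {ρ : Measure S} {μ : Kernel S (A × A)} [IsProbabilityMeasure ρ] [IsMarkovKernel μ]
  {L B κ β τ K : ℝ} {Ω : Type*} [MeasurableSpace Ω] {P : Measure Ω} [IsProbabilityMeasure P]
  {D : Fin n → Ω → Sample S A} {w θhat : Ω → Vec d} {θ : Vec d}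

/-- High-probability error bound for objective perturbation with a general noise level. -/
lemma measure_error_gt_le (hK : 0 < K) (hn : 0 < n) (hφ : Measurable (Function.uncurry φ))
    (hθ : θ ∈ paramSet d B) (hL : ∀ s a, ‖φ s a‖ ≤ L) (hL0 : 0 ≤ L) (hκ : 0 < κ)
    (hcov : MinEigenvalueGe (popCov ρ μ φ) κ) (hβ : 0 ≤ β) (hβK : β * B ≤ K * L * Real.sqrt n)
    (hτ : 0 ≤ τ) (hD : ∀ i, HasLaw (D i) (sampleLaw ρ μ φ θ) P) (hind : iIndepFun D P)
    (hw : HasLaw w (gaussianNoise d τ) P)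
    (hest : ∀ᵐ ω ∂P, IsObjEstimate φ B β (fun i => D i ω) (w ω) (θhat ω))
    {α : ℝ} (hα0 : 0 < α) (hα1 : α < 1) :
    P {ω | (64 + 4 * K) * (L / (κ * gammaCoef L B) * Real.sqrt ((1 + Real.log (1 / α)) / n)
          + τ * (Real.sqrt d + Real.sqrt (Real.log (1 / α))) / (n * κ * gammaCoef L B))
        < ‖θhat ω - θ‖} ≤ ENNReal.ofReal α := by
  have hg := gammaCoef_pos L B
  have hn' : (0 : ℝ) < n := by exact_mod_cast hn
  rcases Nat.eq_zero_or_pos d with rfl | hd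
  · refine le_trans (le_of_eq ?_) zero_le
    convert measure_empty (μ := P)
    ext ω
    simp only [Set.mem_ofPred_eq, Set.mem_empty_iff_false, iff_false, not_lt]
    rw [Subsingleton.elim (θhat ω - θ) 0, norm_zero]
    positivity
  have hd' : (1 : ℝ) ≤ d := by exact_mod_cast hd
  -- If `L = 0`, the second moment vanishes and coverage fails at a unit vector, which exists as `d
  -- ≥ 1`.
  have hLpos : 0 < L := by
    refine hL0.lt_of_ne fun h0 => ?_
    have h1 := mul_sq_norm_le_inner_meanOuter (ρ := ρ) (μ := μ) hφ hL hcov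
      (EuclideanSpace.single ⟨0, hd⟩ 1)
    have h2 := norm_meanOuter_le (ρ := ρ) (μ := μ) hL
    have h3 : meanOuter ρ μ φ = 0 := norm_le_zero_iff.1 (by simpa [← h0] using h2)
    rw [h3, inner_zero_left] at h1
    simp at h1
    linarith
  set l := Real.log (1 / α)
  have hl : 0 ≤ l := Real.log_nonneg (by rw [le_div_iff₀ hα0]; linarith)
  -- Three bad events share the failure probability; the crude `log 3 ≤ 2` absorbs the split.
  have ha : 0 < α / 3 := by positivity
  have hlog : Real.log (1 / (α / 3)) ≤ 2 + l := by
    have e : 1 / (α / 3) = 3 * (1 / α) := by field_simp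
    rw [e, Real.log_mul (by norm_num) (by positivity)]
    have := Real.log_le_sub_one_of_pos (show (0 : ℝ) < 3 by norm_num)
    linarith
  set r := Real.sqrt n
  set q := Real.sqrt (1 + l)
  have hr : (n : ℝ) = r ^ 2 := (Real.sq_sqrt hn'.le).symm
  have hr0 : 0 < r := Real.sqrt_pos.2 hn'
  have hq2 : q ^ 2 = 1 + l := Real.sq_sqrt (by linarith)
  have hq : 1 ≤ q := Real.one_le_sqrt.2 (by linarith)
  have hq0 : 0 ≤ q := by linarith
  rw [Real.sqrt_div (by linarith : (0 : ℝ) ≤ 1 + l)]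
  have hlq : 1 / 2 + Real.log (1 / (α / 3)) ≤ 4 * q ^ 2 := by linarith
  have hsub : ∀ᵐ ω ∂P, ω ∈ {ω | (64 + 4 * K) * (L / (κ * gammaCoef L B) * (q / r)
        + τ * (Real.sqrt d + Real.sqrt l) / (n * κ * gammaCoef L B)) < ‖θhat ω - θ‖} →
      ω ∈ {ω | 4 * n * (2 * L) ^ 2 * (1 / 2 + Real.log (1 / (α / 3))) <
          ‖∑ i, score φ θ (D i ω)‖ ^ 2} ∪
        {ω | 4 * n * (8 * L ^ 2) ^ 2 * (1 / 2 + Real.log (1 / (α / 3))) <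
          ‖∑ i, (outer (diffFeature φ (D i ω).1) - meanOuter ρ μ φ)‖ ^ 2} ∪
        {ω | τ * Real.sqrt (4 * (d / 2 * Real.log 2 + Real.log (1 / (α / 3)))) < ‖w ω‖} := by
    filter_upwards [hest] with ω hω
    contrapose!
    simp only [Set.mem_union, Set.mem_ofPred_eq, not_or, not_lt]
    rintro ⟨⟨h1, h2⟩, h3⟩
    refine error_le_of_bounds hr hr0 hκ hLpos hg hK (two_mul_mul_gammaCoef_le L B)
      (norm_nonneg _) ?_ hq hβK (by positivity) ?_ ?_ ?_
      (hω.basic_inequality hL hβ hθ) (sum_sq_inner_ge (ρ := ρ) (μ := μ) hφ hL hcov _ _)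
    · linarith [norm_sub_le (θhat ω) θ, hω.1.2, hθ.2]
    · refine le_of_sq_le_sq (h1.trans ?_) (by positivity)
      calc 4 * (n : ℝ) * (2 * L) ^ 2 * (1 / 2 + Real.log (1 / (α / 3)))
          ≤ 4 * n * (2 * L) ^ 2 * (4 * q ^ 2) := by gcongr
        _ = (8 * L * r * q) ^ 2 := by rw [hr]; ring
    · refine le_of_sq_le_sq (h2.trans ?_) (by positivity)
      calc 4 * (n : ℝ) * (8 * L ^ 2) ^ 2 * (1 / 2 + Real.log (1 / (α / 3)))
          ≤ 4 * n * (8 * L ^ 2) ^ 2 * (4 * q ^ 2) := by gcongr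
        _ = (32 * L ^ 2 * r * q) ^ 2 := by rw [hr]; ring
    · refine h3.trans ?_
      rw [mul_left_comm]
      gcongr
      -- The radicand is at most `2d + 8 + 4l`; as `d ≥ 1`, this is below `16(√d + √l)²`.
      refine Real.sqrt_le_iff.2 ⟨by positivity, ?_⟩
      have e1 : Real.sqrt d ^ 2 = d := Real.sq_sqrt (by positivity)
      have e2 : Real.sqrt l ^ 2 = l := Real.sq_sqrt hl
      have e3 : 0 ≤ Real.sqrt d * Real.sqrt l := by positivity
      have e4 : Real.log 2 ≤ 1 := by
        have := Real.log_le_sub_one_of_pos (show (0 : ℝ) < 2 by norm_num)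
        linarith
      have e5 : (d : ℝ) / 2 * Real.log 2 ≤ d / 2 * 1 := by gcongr
      nlinarith
  calc _ ≤ _ := measure_mono_ae hsub
    _ ≤ ENNReal.ofReal (α / 3) + ENNReal.ofReal (α / 3) + ENNReal.ofReal (α / 3) := by
        refine (measure_union_le _ _).trans (add_le_add ((measure_union_le _ _).trans
          (add_le_add ?_ ?_)) ?_)
        · exact measure_norm_sum_score_gt_le hn hφ hLpos hL hD hind ha
        · exact measure_norm_sum_outer_gt_le hn hφ hLpos hL hD hind ha
        · exact measure_norm_gaussianNoise_gt_le hτ hw ha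
    _ = ENNReal.ofReal α := by
        rw [← ENNReal.ofReal_add (by positivity) (by positivity),
          ← ENNReal.ofReal_add (by positivity) (by positivity)]
        congr 1
        ring

lemma sqrt_one_add_div_le {l m : ℝ} (hl : 1 / 3 ≤ l) (hm : 0 < m) :
    Real.sqrt ((1 + l) / m) ≤ 2 * Real.sqrt (l / m) := by
  refine Real.sqrt_le_iff.2 ⟨by positivity, ?_⟩
  rw [mul_pow, Real.sq_sqrt (by positivity), ← mul_div_assoc]
  gcongr
  linarith

/-- Since `log(2/δ) ≥ log 2 > 1/2`, the term `4ε ≤ 4` is at most `8 log(2/δ)`. -/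
lemma privacyNoise_le {L ε δ : ℝ} (hL : 0 ≤ L) (hε0 : 0 < ε) (hε1 : ε ≤ 1) (hδ0 : 0 < δ)
    (hδ1 : δ < 1) : privacyNoise L ε δ ≤ 4 * (L * Real.sqrt (Real.log (2 / δ)) / ε) := by
  have h1 : Real.log 2 ≤ Real.log (2 / δ) := by
    refine Real.log_le_log (by norm_num) ?_
    rw [le_div_iff₀ hδ0]
    linarith
  have h2 := Real.log_two_gt_d9
  have h3 : Real.sqrt (8 * Real.log (2 / δ) + 4 * ε) ≤ 4 * Real.sqrt (Real.log (2 / δ)) := by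
    refine Real.sqrt_le_iff.2 ⟨by positivity, ?_⟩
    rw [mul_pow, Real.sq_sqrt (by linarith)]
    linarith
  calc privacyNoise L ε δ ≤ L * (4 * Real.sqrt (Real.log (2 / δ))) / ε := by
        unfold privacyNoise
        gcongr
    _ = _ := by ring

/-- Comparison of the general error bound with the one for the private noise level. -/
lemma private_threshold_le {n d : ℕ} (hn : 0 < n) (hd : 0 < d) {C c L κ g l τ ε Λ : ℝ}
    (hC : 0 ≤ C) (hc : 1 ≤ c) (hL : 0 ≤ L) (hκ : 0 < κ) (hg : 0 < g) (hl : 0 ≤ l) (hε : 0 < ε)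
    (hτ : τ ≤ c * (L * Real.sqrt Λ / ε)) :
    C * (L / (κ * g) * Real.sqrt ((1 + l) / n)
        + τ * (Real.sqrt d + Real.sqrt l) / (n * κ * g)) ≤
      2 * c * C * Real.sqrt (1 + l) *
        (L / (κ * g * Real.sqrt n) + L * Real.sqrt (d * Λ) / (n * ε * κ * g)) := by
  have hn' : (0 : ℝ) < n := by exact_mod_cast hn
  have hd' : 1 ≤ Real.sqrt d := Real.one_le_sqrt.2 (by exact_mod_cast hd)
  rw [Real.sqrt_div (by linarith), Real.sqrt_mul (by positivity) Λ]
  set q := Real.sqrt (1 + l)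
  have hq : 1 ≤ q := Real.one_le_sqrt.2 (by linarith)
  have hlq : Real.sqrt l ≤ q := Real.sqrt_le_sqrt (by linarith)
  -- Two numbers that are at least `1` have sum at most twice their product.
  have hsum : Real.sqrt d + Real.sqrt l ≤ 2 * (q * Real.sqrt d) := by
    nlinarith [mul_nonneg (sub_nonneg.2 hd') (sub_nonneg.2 hq)]
  have hr0 : 0 < Real.sqrt n := Real.sqrt_pos.2 hn'
  have h1 : L / (κ * g) * (q / Real.sqrt n) ≤ 2 * c * (q * (L / (κ * g * Real.sqrt n))) := by
    calc L / (κ * g) * (q / Real.sqrt n) = 1 * (q * (L / (κ * g * Real.sqrt n))) := by field_simp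
      _ ≤ _ := by gcongr; linarith
  have h2 : τ * (Real.sqrt d + Real.sqrt l) / (n * κ * g) ≤
      2 * c * (q * (L * (Real.sqrt d * Real.sqrt Λ) / (n * ε * κ * g))) := by
    calc τ * (Real.sqrt d + Real.sqrt l) / (n * κ * g)
        ≤ c * (L * Real.sqrt Λ / ε) * (2 * (q * Real.sqrt d)) / (n * κ * g) := by gcongr
      _ = _ := by field_simp
  calc _ ≤ C * (2 * c * (q * (L / (κ * g * Real.sqrt n))) +
        2 * c * (q * (L * (Real.sqrt d * Real.sqrt Λ) / (n * ε * κ * g)))) := by gcongr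
    _ = _ := by ring

end MainBound

end PrefReward

theorem mainTheorem7 (K : ℝ) (hK : 0 < K) :
    ∃ C : ℝ, 0 < C ∧
      ∀ (d n : ℕ) (_hn : 0 < n)
        (S : Type*) (_ : MeasurableSpace S) (A : Type*) (_ : MeasurableSpace A)
        (ρ : Measure S) (_ : IsProbabilityMeasure ρ)
        (μ : Kernel S (A × A)) (_ : IsMarkovKernel μ)
        (φ : S → A → PrefReward.Vec d) (_hφ : Measurable (Function.uncurry φ))
        (B L κ : ℝ) (θstar : PrefReward.Vec d)
        -- boundedness
        (_hθ : θstar ∈ PrefReward.paramSet d B) (_hL : ∀ s a, ‖φ s a‖ ≤ L)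
        -- coverage
        (_hκ : 0 < κ) (_hcov : PrefReward.MinEigenvalueGe (PrefReward.popCov ρ μ φ) κ)
        -- regularization and noise level
        (β : ℝ) (_hβ : 0 < β) (_hβK : β * B ≤ K * L * Real.sqrt n)
        (τ : ℝ) (_hτ : 0 ≤ τ)
        -- i.i.d. dataset, independent Gaussian noise, and the resulting estimator
        (Ω : Type*) (_ : MeasurableSpace Ω) (P : Measure Ω) (_ : IsProbabilityMeasure P)
        (D : Fin n → Ω → PrefReward.Sample S A) (w : Ω → PrefReward.Vec d)
        (_hD : ∀ i, HasLaw (D i) (PrefReward.sampleLaw ρ μ φ θstar) P)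
        (_hiid : iIndepFun D P)
        (_hw : HasLaw w (PrefReward.gaussianNoise d τ) P)
        (_hind : IndepFun (fun ω i => D i ω) w P)
        (θhat : Ω → PrefReward.Vec d)
        (_hest : ∀ᵐ ω ∂P, PrefReward.IsObjEstimate φ B β (fun i => D i ω) (w ω) (θhat ω))
        (α : ℝ) (_hα0 : 0 < α) (_hα1 : α < 1),
        -- general noise level, every `α` in `(0, 1)`
        P {ω | C * (L / (κ * PrefReward.gammaCoef L B) * Real.sqrt ((1 + Real.log (1 / α)) / n)
              + τ * (Real.sqrt d + Real.sqrt (Real.log (1 / α)))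
                / (n * κ * PrefReward.gammaCoef L B))
            < ‖θhat ω - θstar‖} ≤ ENNReal.ofReal α ∧
        -- general noise level, `α` at most `1 / 2`
        (α ≤ 1 / 2 →
          P {ω | C * (L / (κ * PrefReward.gammaCoef L B) * Real.sqrt (Real.log (1 / α) / n)
                + τ * (Real.sqrt d + Real.sqrt (Real.log (1 / α)))
                  / (n * κ * PrefReward.gammaCoef L B))
              < ‖θhat ω - θstar‖} ≤ ENNReal.ofReal α) ∧
        -- the noise level that is used for privacy
        (∀ ε δ : ℝ, 0 < ε → ε ≤ 1 → 0 < δ → δ < 1 → τ = PrefReward.privacyNoise L ε δ →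
          P {ω | C * Real.sqrt (1 + Real.log (1 / α)) *
                (L / (κ * PrefReward.gammaCoef L B * Real.sqrt n)
                  + L * Real.sqrt (d * Real.log (2 / δ))
                    / (n * ε * κ * PrefReward.gammaCoef L B))
              < ‖θhat ω - θstar‖} ≤ ENNReal.ofReal α ∧
          (δ ≤ 1 / 2 →
            P {ω | C * Real.sqrt (1 + Real.log (1 / α)) *
                  (L / (κ * PrefReward.gammaCoef L B * Real.sqrt n)
                    + L * Real.sqrt (d * Real.log (1 / δ))
                      / (n * ε * κ * PrefReward.gammaCoef L B))
                < ‖θhat ω - θstar‖} ≤ ENNReal.ofReal α)) := by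
  obtain hK' : 0 < 64 + 4 * K := by linarith
  -- The factor `16 = 2 · 8` is set by the `log(1/δ)` bound, where `private_threshold_le` is used
  -- with `c = 8`.
  refine ⟨16 * (64 + 4 * K), by positivity, ?_⟩
  intro d n hn S _ A _ ρ _ μ _ φ hφ B L κ θstar hθ hL hκ hcov β hβ hβK τ hτ Ω _ P _ D w hD hiid hw
    _ θhat hest α hα0 hα1
  have hn' : (0 : ℝ) < n := by exact_mod_cast hn
  have hL0 : 0 ≤ L := by
    obtain ⟨s⟩ := nonempty_of_isProbabilityMeasure ρ
    obtain ⟨a⟩ := nonempty_of_isProbabilityMeasure (μ s)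
    exact (norm_nonneg _).trans (hL s a.1)
  have hg := PrefReward.gammaCoef_pos L B
  have hl : 0 ≤ Real.log (1 / α) := Real.log_nonneg (by rw [le_div_iff₀ hα0]; linarith)
  have main := PrefReward.measure_error_gt_le hK hn hφ hθ hL hL0 hκ hcov hβ.le hβK hτ hD hiid hw
    hest hα0 hα1
  have weaken : ∀ {T : ℝ}, (64 + 4 * K) *
      (L / (κ * PrefReward.gammaCoef L B) * Real.sqrt ((1 + Real.log (1 / α)) / n)
        + τ * (Real.sqrt d + Real.sqrt (Real.log (1 / α))) / (n * κ * PrefReward.gammaCoef L B))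
        ≤ T → P {ω | T < ‖θhat ω - θstar‖} ≤ ENNReal.ofReal α := fun hT =>
    (measure_mono fun _ hω => lt_of_le_of_lt hT hω).trans main
  refine ⟨weaken ?_, fun hα2 => weaken ?_, fun ε δ hε0 hε1 hδ0 hδ1 hτε => ?_⟩
  · gcongr
    linarith
  -- As `log 2 > 1/3`, one has `1 + log(1/α) ≤ 4 log(1/α)`.
  · have hl3 : 1 / 3 ≤ Real.log (1 / α) := by
      have h1 : Real.log 2 ≤ Real.log (1 / α) := by
        refine Real.log_le_log (by norm_num) ?_
        rw [le_div_iff₀ hα0]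
        linarith
      linarith [Real.log_two_gt_d9]
    calc _ ≤ (64 + 4 * K) * (L / (κ * PrefReward.gammaCoef L B) *
          (16 * Real.sqrt (Real.log (1 / α) / n)) + 16 * (τ * (Real.sqrt d +
            Real.sqrt (Real.log (1 / α))) / (n * κ * PrefReward.gammaCoef L B))) := by
          gcongr
          · refine (PrefReward.sqrt_one_add_div_le hl3 hn').trans ?_
            gcongr
            norm_num
          · exact le_mul_of_one_le_left (by positivity) (by norm_num)
      _ = _ := by ring
  have hτ4 := hτε.trans_le (PrefReward.privacyNoise_le hL0 hε0 hε1 hδ0 hδ1)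
  rcases Nat.eq_zero_or_pos d with rfl | hd
  · have hzero : ∀ {T : ℝ}, 0 ≤ T → P {ω | T < ‖θhat ω - θstar‖} ≤ ENNReal.ofReal α := fun hT => by
      refine (measure_mono_null (fun ω hω => ?_) (measure_empty (μ := P))).trans_le zero_le
      rw [Set.mem_ofPred_eq, Subsingleton.elim (θhat ω - θstar) 0, norm_zero] at hω
      exact absurd hω hT.not_gt
    exact ⟨hzero (by positivity), fun _ => hzero (by positivity)⟩
  refine ⟨weaken ?_, fun hδ2 => weaken ?_⟩
  · refine (PrefReward.private_threshold_le hn hd hK'.le (by norm_num) hL0 hκ hg hl hε0 hτ4).trans ?_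
    gcongr
    linarith
  -- For `δ ≤ 1/2` the summand `log 2` is at most `log(1/δ)`, at the price of doubling the constant
  -- from `4` to `8`.
  · have hlog : Real.sqrt (Real.log (2 / δ)) ≤ 2 * Real.sqrt (Real.log (1 / δ)) := by
      have h1 : Real.log 2 ≤ Real.log (1 / δ) := by
        refine Real.log_le_log (by norm_num) ?_
        rw [le_div_iff₀ hδ0]
        linarith
      have h2 : Real.log (2 / δ) = Real.log 2 + Real.log (1 / δ) := by
        rw [← Real.log_mul (by norm_num) (by positivity)]
        ring_nf
      have h3 := Real.log_two_gt_d9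
      refine Real.sqrt_le_iff.2 ⟨by positivity, ?_⟩
      rw [mul_pow, Real.sq_sqrt (by linarith)]
      linarith
    have hτ8 : τ ≤ 8 * (L * Real.sqrt (Real.log (1 / δ)) / ε) := by
      calc τ ≤ 4 * (L * Real.sqrt (Real.log (2 / δ)) / ε) := hτ4
        _ ≤ 4 * (L * (2 * Real.sqrt (Real.log (1 / δ))) / ε) := by gcongr
        _ = _ := by ring
    refine (PrefReward.private_threshold_le hn hd hK'.le (by norm_num) hL0 hκ hg hl hε0 hτ8).trans ?_
    gcongr
    linarith
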